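/- Let $n\ge 3$, let $[n]=\{1,\dots,n\}$, and let $(D_S)_{S\subseteq[n],\,|S|\ge 2}$ be a family of positive real numbers. Write $D_{i,j}=D_{\{i,j\}}$ for $i\ne j$, and put $D_{i,i}=0$. For a finite simple connected graph $G$ with edge weights $w:E(G)\to\mathbb{R}_{>0}$ and $S\subseteq V(G)$ with $|S|\ge 2$, let $$D_S(G,w)=\min\Big\{\sum_{e\in E(R)}w(e)\ :\ R\text{ a connected subgraph of }G\text{ with }S\subseteq V(R)\Big\}.$$ For a set $X$ of $2$-element subsets of $[n]$, let $G_X$ be the graph with edge set $X$ and vertex set $\bigcup_{I\in X}I$, and let $L(G_X)$ be the set of its leaves (vertices of degree one). Then there exists a tree $T$ with vertex set exactly $[n]$ and positive edge weights $w$ such that $D_S(T,w)=D_S$ for every $S\subseteq[n]$ with $|S|\ge 2$ if and only if the following three conditions hold: (i) (4-point condition) for all $a,b,c,d\in[n]$, the maximum of the three numbers $D_{a,b}+D_{c,d}$, $D_{a,c}+D_{b,d}$, $D_{a,d}+D_{b,c}$ is attained at least twice; (ii) (median family) for all pairwise distinct $a,b,c\in[n]$ there exists a unique $m\in[n]$ such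 that $D_{i,j}=D_{i,m}+D_{j,m}$ for all distinct $i,j\in\{a,b,c\}$; (iii) for every $S\subseteq[n]$ with $|S|\ge 3$, $$D_S=\min\Big\{\sum_{I\in X}D_I\ :\ X\text{ a set of }2\text{-element subsets of }[n],\ G_X\text{ is a tree},\ L(G_X)\subseteq S\subseteq V(G_X)\Big\}.$$ -/

import Mathlib

namespace TreeMultiweights

/-- `w(R)`: the sum of the weights of the edges of the subgraph `R` of the weighted graph
`(G, w)`. -/
noncomputable def subgraphWeight {V : Type*} [Fintype V] {G : SimpleGraph V}
    (w : G.edgeSet → ℝ) (R : G.Subgraph) : ℝ :=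
  open Classical in
  ∑ e : G.edgeSet, if (e : Sym2 V) ∈ R.edgeSet then w e else 0

/-- `d` is the multiweight `D_S(G, w)`, that is, the minimum of the weights `w(R)` over the
connected subgraphs `R` of `G` whose vertex set contains `S`. -/
def IsMultiweight {V : Type*} [Fintype V] (G : SimpleGraph V) (w : G.edgeSet → ℝ)
    (S : Finset V) (d : ℝ) : Prop :=
  IsLeast {x : ℝ | ∃ R : G.Subgraph,
    R.Connected ∧ (S : Set V) ⊆ R.verts ∧ x = subgraphWeight w R} d

/-- The 2-weight `D_{i,j}` of a family `D`, with the usual convention `D_{i,i} = 0`. -/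
def pairWeight {V : Type*} [DecidableEq V] (D : Finset V → ℝ) (i j : V) : ℝ :=
  if i = j then 0 else D {i, j}

/-- The maximum of `x, y, z` is attained at least twice. -/
def MaxAttainedTwice (x y z : ℝ) : Prop :=
  (x = y ∧ z ≤ x) ∨ (x = z ∧ y ≤ x) ∨ (y = z ∧ x ≤ y)

/-- The 4-point condition for the 2-weights of the family `D`. -/
def FourPointCondition {V : Type*} [DecidableEq V] (D : Finset V → ℝ) : Prop :=
  ∀ a b c d : V, MaxAttainedTwice
    (pairWeight D a b + pairWeight D c d)
    (pairWeight D a c + pairWeight D b d)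
    (pairWeight D a d + pairWeight D b c)

/-- The 2-weights of `D` form a median family: any three distinct elements have a unique
median. (For `a, b, c` not distinct, uniqueness could never hold.) -/
def IsMedianFamily {V : Type*} [DecidableEq V] (D : Finset V → ℝ) : Prop :=
  ∀ a b c : V, a ≠ b → a ≠ c → b ≠ c →
    ∃! m : V, ∀ i ∈ ({a, b, c} : Set V), ∀ j ∈ ({a, b, c} : Set V), i ≠ j →
      pairWeight D i j = pairWeight D i m + pairWeight D j m

/-- The graph `G_X` of a set `X` of 2-subsets of `V`: its edges are the elements of `X`, its
vertices are the elements of their union. It is given as a subgraph of the complete graph. -/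
def graphOf {V : Type*} [DecidableEq V] (X : Finset (Finset V)) :
    (⊤ : SimpleGraph V).Subgraph where
  verts := {v | ∃ I ∈ X, v ∈ I}
  Adj u v := u ≠ v ∧ ({u, v} : Finset V) ∈ X
  adj_sub h := h.1
  edge_vert h := ⟨_, h.2, by simp⟩
  symm := ⟨fun u v h => ⟨h.1.symm, by rw [Finset.pair_comm]; exact h.2⟩⟩

/-- The leaves (vertices of degree one) of a subgraph. -/
def leaves {V : Type*} {G : SimpleGraph V} (H : G.Subgraph) : Set V :=
  {v | v ∈ H.verts ∧ ∃! u, H.Adj v u}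

/-- The sums `∑_{I ∈ X} D_I`, where `X` ranges over the sets of 2-subsets of `V` such that
`G_X` is a tree and `L(G_X) ⊆ S ⊆ V(G_X)`. -/
def treeSums {V : Type*} [DecidableEq V] (D : Finset V → ℝ) (S : Finset V) : Set ℝ :=
  {x | ∃ X : Finset (Finset V), (∀ I ∈ X, I.card = 2) ∧ (graphOf X).coe.IsTree ∧
    leaves (graphOf X) ⊆ (S : Set V) ∧ (S : Set V) ⊆ (graphOf X).verts ∧
    x = ∑ I ∈ X, D I}

end TreeMultiweights

/-!
The two directions rest on the same picture: in a tree with positive edge weights, the 2-weight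
`D_{a,b}` is the weight of the path from `a` to `b`, and a vertex `m` lies on that path if and only
if every walk from `a` to `b` passes through `m` (`Separates`), if and only if
`D_{a,b} = D_{a,m} + D_{m,b}`.

**From a tree to the conditions.** Any three vertices have a common point `m` of their three
connecting paths (`exists_median`); this gives the median family. If `m` lies between `a` and `b`,
then for every `p` it lies between `a` and `p` or between `p` and `b` (`Separates.or`), as
otherwise two walks avoiding `m` could be concatenated. So, with `m` the median of `a, b, c`, the
vertex `m` lies on the paths to `p` from at least two of `a, b, c`. The two corresponding sums are
equal to `D_{a,m} + D_{b,m} + D_{c,m} + D_{m,p}`, and the third sum is at most that: this is the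
4-point condition. For the formula for `D_S` (`isLeast_treeSums_of_isTree`), a connected subgraph
of least weight containing `S` is a tree whose leaves lie in `S`, since another leaf could be
removed; conversely, if `G_X` is connected and contains `S`, the union over `I ∈ X` of
subgraphs realizing `D_I` is connected, contains `S`, and weighs at most `∑_{I ∈ X} D_I`.

**From the conditions to a tree.** Join `u` and `v` when no third vertex lies metrically between
them (`coverGraph`), with weight `D_{u,v}`. Splitting a pair at an intermediate vertex as long as
possible yields a walk from `a` to `b` of weight at most `D_{a,b}`, so the graph is connected, and
by the triangle inequality no path is lighter. It is acyclic because each edge `uv` is a bridge: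
the median of `x, u, v` is `u` or `v`, so each vertex `x` is on the side of `u` or on the side of
`v`, and the 4-point condition shows that the only edge between the two sides is `uv`
(`coverGraph_isAcyclic`). Thus the 2-weights are realized by this tree. The multiweights of the tree
satisfy the formula of the first direction, whose right-hand side involves 2-weights only, so they
agree with `D` on all larger sets.
-/

namespace TreeMultiweights

open SimpleGraph

/-! ### Weights of subgraphs -/

section Weight

variable {V : Type*} [Fintype V] {G : SimpleGraph V} {w : G.edgeSet → ℝ}

theorem subgraphWeight_mono (hw : ∀ e, 0 < w e) {R R' : G.Subgraph} (h : R ≤ R') :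
    subgraphWeight w R ≤ subgraphWeight w R' := by
  unfold subgraphWeight
  refine Finset.sum_le_sum fun e _ => ?_
  have := hw e
  by_cases h1 : (e : Sym2 V) ∈ R.edgeSet
  · simp [h1, Subgraph.edgeSet_mono h h1]
  · rw [if_neg h1]
    split_ifs <;> linarith

theorem subgraphWeight_sup_le (hw : ∀ e, 0 < w e) (R R' : G.Subgraph) :
    subgraphWeight w (R ⊔ R') ≤ subgraphWeight w R + subgraphWeight w R' := by
  unfold subgraphWeight
  rw [← Finset.sum_add_distrib]
  refine Finset.sum_le_sum fun e _ => ?_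
  have := hw e
  by_cases h1 : (e : Sym2 V) ∈ R.edgeSet <;> by_cases h2 : (e : Sym2 V) ∈ R'.edgeSet <;>
    simp [h1, h2, this.le]

theorem subgraphWeight_sup (R R' : G.Subgraph) (h : Disjoint R.edgeSet R'.edgeSet) :
    subgraphWeight w (R ⊔ R') = subgraphWeight w R + subgraphWeight w R' := by
  unfold subgraphWeight
  rw [← Finset.sum_add_distrib]
  refine Finset.sum_congr rfl fun e _ => ?_
  by_cases h1 : (e : Sym2 V) ∈ R.edgeSet <;> by_cases h2 : (e : Sym2 V) ∈ R'.edgeSet <;>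
    simp [h1, h2]
  exact (Set.disjoint_left.1 h h1 h2).elim

theorem subgraphWeight_nil (v : V) :
    subgraphWeight w (Walk.nil : G.Walk v v).toSubgraph = 0 := by
  unfold subgraphWeight
  simp

theorem subgraphWeight_subgraphOfAdj {u v : V} (h : G.Adj u v) :
    subgraphWeight w (G.subgraphOfAdj h) = w ⟨s(u, v), h⟩ := by
  classical
  unfold subgraphWeight
  rw [Finset.sum_eq_single ⟨s(u, v), h⟩]
  · simp
  · rintro ⟨e, he⟩ _ hne
    have hne' : e ≠ s(u, v) := fun h' => hne (Subtype.ext h')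
    simp [hne']
  · simp

theorem subgraphWeight_append {a b c : V} {p : G.Walk a b} {q : G.Walk b c}
    (h : (p.append q).IsPath) :
    subgraphWeight w (p.append q).toSubgraph =
      subgraphWeight w p.toSubgraph + subgraphWeight w q.toSubgraph := by
  rw [Walk.toSubgraph_append, subgraphWeight_sup]
  rw [Set.disjoint_left]
  intro e h1 h2
  rw [Walk.mem_edges_toSubgraph] at h1 h2
  have := h.isTrail.edges_nodup
  rw [Walk.edges_append] at this
  exact List.disjoint_of_nodup_append this h1 h2

theorem exists_isMultiweight (hG : G.Connected) (w : G.edgeSet → ℝ) (S : Finset V) :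
    ∃ d, IsMultiweight G w S d := by
  set A := {x : ℝ | ∃ R : G.Subgraph,
    R.Connected ∧ (S : Set V) ⊆ R.verts ∧ x = subgraphWeight w R}
  have hfin : A.Finite := by
    refine (Set.finite_range (fun R : G.Subgraph => subgraphWeight w R)).subset ?_
    rintro x ⟨R, -, -, rfl⟩
    exact ⟨R, rfl⟩
  have hne : A.Nonempty :=
    ⟨_, ⊤, by rw [Subgraph.connected_iff']; exact (Subgraph.topIso.connected_iff).2 hG,
      by simp, rfl⟩
  exact ⟨_, hfin.isCompact.isLeast_sInf hne⟩

end Weight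

/-! ### Paths and medians in trees -/

section Tree

variable {V : Type*} {T : SimpleGraph V}

/-- In an acyclic graph, a connected subgraph contains the path between any two of its vertices. -/
theorem toSubgraph_le_of_isPath (hT : T.IsAcyclic) {u v : V} {p : T.Walk u v} (hp : p.IsPath)
    {R : T.Subgraph} (hR : R.Connected) (hu : u ∈ R.verts) (hv : v ∈ R.verts) :
    p.toSubgraph ≤ R := by
  classical
  obtain ⟨q, hq⟩ := (Subgraph.connected_iff_forall_exists_walk_subgraph R).1 hR |>.2 hu hv
  have : p = q.bypass :=
    congrArg Subtype.val
      ((hT.subsingleton_path _ _).elim ⟨p, hp⟩ ⟨q.bypass, q.bypass_isPath⟩)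
  rw [this]
  exact Walk.toSubgraph_bypass_le_toSubgraph.trans hq

theorem mem_support_of_isPath (hT : T.IsAcyclic) {a b m : V} {p : T.Walk a b} (hp : p.IsPath)
    (hm : m ∈ p.support) (q : T.Walk a b) : m ∈ q.support := by
  classical
  have : p = q.bypass :=
    congrArg Subtype.val
      ((hT.subsingleton_path _ _).elim ⟨p, hp⟩ ⟨q.bypass, q.bypass_isPath⟩)
  rw [this] at hm
  exact q.support_bypass_subset_support hm

/-- Every walk from `a` to `b` passes through `m`. In a tree this says that `m` lies on the path
from `a` to `b`; the endpoints `m = a` and `m = b` are allowed. -/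
def Separates (T : SimpleGraph V) (m a b : V) : Prop :=
  ∀ p : T.Walk a b, m ∈ p.support

theorem Separates.symm {m a b : V} (h : Separates T m a b) : Separates T m b a := fun p => by
  simpa using h p.reverse

theorem Separates.or {m a b : V} (h : Separates T m a b) (c : V) :
    Separates T m a c ∨ Separates T m c b := by
  by_contra hc
  simp only [Separates, not_or, not_forall] at hc
  obtain ⟨⟨p, hp⟩, q, hq⟩ := hc
  have := h (p.append q)
  rw [Walk.mem_support_append_iff] at this
  tauto

/-- Any three vertices of a tree have a median: the first vertex of the path from `c` to `a` that
lies on the path from `a` to `b`. -/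
theorem exists_median (hT : T.IsTree) (a b c : V) :
    ∃ m, Separates T m a b ∧ Separates T m a c ∧ Separates T m b c := by
  classical
  obtain ⟨P, hP⟩ := hT.connected.exists_isPath a b
  obtain ⟨Q, hQ⟩ := hT.connected.exists_isPath c a
  obtain ⟨m, hmP, hmQ, hm⟩ := Q.exists_mem_support_forall_mem_support_imp_eq P.support.toFinset
    ⟨a, by simp⟩
  simp only [List.mem_toFinset] at hmP hm
  refine ⟨m, mem_support_of_isPath hT.isAcyclic hP hmP,
    Separates.symm (mem_support_of_isPath hT.isAcyclic hQ hmQ), Separates.symm ?_⟩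
  -- `m` is the only common vertex of the two parts, so they form the path from `c` to `b`
  have hpath : ((Q.takeUntil m hmQ).append (P.dropUntil m hmP)).IsPath := by
    rw [Walk.isPath_def, Walk.support_append, List.nodup_append']
    refine ⟨(hQ.takeUntil hmQ).support_nodup, (hP.dropUntil hmP).support_nodup.tail, ?_⟩
    intro x hx hx'
    have := hm x (P.support_dropUntil_subset_support hmP (List.mem_of_mem_tail hx')) hx
    subst this
    have h2 := (hP.dropUntil hmP).support_nodup
    rw [← Walk.cons_tail_support] at h2
    exact (List.nodup_cons.1 h2).1 hx'
  refine mem_support_of_isPath hT.isAcyclic hpath ?_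
  rw [Walk.mem_support_append_iff]
  simp

end Tree

/-! ### Elementary properties of the 2-weights -/

section Pairs

variable {V : Type*} [DecidableEq V] {D : Finset V → ℝ}

theorem pairWeight_self (a : V) : pairWeight D a a = 0 := by simp [pairWeight]

theorem pairWeight_of_ne {a b : V} (h : a ≠ b) : pairWeight D a b = D {a, b} := by
  simp [pairWeight, h]

theorem pairWeight_comm (a b : V) : pairWeight D a b = pairWeight D b a := by
  unfold pairWeight
  rw [Finset.pair_comm]
  simp [eq_comm]

theorem pairWeight_pos (hD : ∀ S : Finset V, 2 ≤ S.card → 0 < D S) {a b : V} (h : a ≠ b) :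
    0 < pairWeight D a b := by
  rw [pairWeight_of_ne h]
  exact hD _ (Finset.card_pair h).ge

theorem pairWeight_nonneg (hD : ∀ S : Finset V, 2 ≤ S.card → 0 < D S) (a b : V) :
    0 ≤ pairWeight D a b := by
  by_cases h : a = b
  · simp [h, pairWeight_self]
  · exact (pairWeight_pos hD h).le

theorem eq_of_pairWeight_nonpos (hD : ∀ S : Finset V, 2 ≤ S.card → 0 < D S) {a b : V}
    (h : pairWeight D a b ≤ 0) : a = b := by
  by_contra hne
  exact (pairWeight_pos hD hne).not_ge h

end Pairs

/-! ### The 2-weights of a weighted tree -/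

section OfTree

variable {V : Type*} [Fintype V] {T : SimpleGraph V} {w : T.edgeSet → ℝ}

theorem isMultiweight_pair [DecidableEq V] (hT : T.IsAcyclic) (hw : ∀ e, 0 < w e) {a b : V}
    {p : T.Walk a b} (hp : p.IsPath) :
    IsMultiweight T w {a, b} (subgraphWeight w p.toSubgraph) := by
  refine ⟨⟨p.toSubgraph, p.toSubgraph_connected, by simp [Set.insert_subset_iff], rfl⟩, ?_⟩
  rintro x ⟨R, hR, hS, rfl⟩
  exact subgraphWeight_mono hw (toSubgraph_le_of_isPath hT hp hR (hS (by simp)) (hS (by simp)))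

variable [DecidableEq V] {D : Finset V → ℝ}

/-- This includes `a = b`, where both sides vanish. -/
theorem pairWeight_eq_subgraphWeight (hT : T.IsAcyclic) (hw : ∀ e, 0 < w e)
    (hm : ∀ S : Finset V, 2 ≤ S.card → IsMultiweight T w S (D S)) {a b : V}
    {p : T.Walk a b} (hp : p.IsPath) :
    pairWeight D a b = subgraphWeight w p.toSubgraph := by
  by_cases h : a = b
  · subst h
    rw [Walk.isPath_iff_nil.1 hp |>.eq_nil, subgraphWeight_nil, pairWeight_self]
  · rw [pairWeight_of_ne h]
    exact (hm _ (Finset.card_pair h).ge).unique (isMultiweight_pair hT hw hp)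

theorem apply_pair_of_adj (hT : T.IsAcyclic) (hw : ∀ e, 0 < w e)
    (hm : ∀ S : Finset V, 2 ≤ S.card → IsMultiweight T w S (D S)) (e : T.edgeSet) :
    D (e : Sym2 V).toFinset = w e := by
  obtain ⟨⟨a, b⟩, h⟩ := e
  have h' : T.Adj a b := h
  have hp : h'.toWalk.IsPath := by simp [Adj.toWalk, h'.ne]
  have := pairWeight_eq_subgraphWeight hT hw hm hp
  rw [pairWeight_of_ne h'.ne, Adj.toSubgraph_toWalk, subgraphWeight_subgraphOfAdj] at this
  rw [← this]
  exact congrArg D Sym2.toFinset_mk_eq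

theorem pairWeight_add_of_separates (hT : T.IsTree) (hw : ∀ e, 0 < w e)
    (hm : ∀ S : Finset V, 2 ≤ S.card → IsMultiweight T w S (D S)) {m a b : V}
    (h : Separates T m a b) :
    pairWeight D a b = pairWeight D a m + pairWeight D m b := by
  obtain ⟨p, hp⟩ := hT.connected.exists_isPath a b
  have hmp := h p
  have h1 := pairWeight_eq_subgraphWeight hT.isAcyclic hw hm (hp.takeUntil hmp)
  have h2 := pairWeight_eq_subgraphWeight hT.isAcyclic hw hm (hp.dropUntil hmp)
  have h3 := pairWeight_eq_subgraphWeight hT.isAcyclic hw hm hp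
  have h4 := p.take_spec hmp
  rw [← h4] at h3 hp
  rw [h3, h1, h2, subgraphWeight_append hp]

theorem fourPointCondition_of_isTree (hT : T.IsTree) (hw : ∀ e, 0 < w e)
    (hD : ∀ S : Finset V, 2 ≤ S.card → 0 < D S)
    (hm : ∀ S : Finset V, 2 ≤ S.card → IsMultiweight T w S (D S)) :
    FourPointCondition D := by
  intro a b c p
  -- `p` is attached to the tripod of `a, b, c` with centre `m`
  obtain ⟨m, hab, hac, hbc⟩ := exists_median hT a b c
  have add := fun {x y : V} (h : Separates T m x y) => pairWeight_add_of_separates hT hw hm h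
  have tri : ∀ x, pairWeight D x p ≤ pairWeight D x m + pairWeight D m p := by
    intro x
    obtain ⟨k, h1, h2, h3⟩ := exists_median hT x p m
    have e1 := pairWeight_add_of_separates hT hw hm h1
    have e2 := pairWeight_add_of_separates hT hw hm h2
    have e3 := pairWeight_add_of_separates hT hw hm h3.symm
    have := pairWeight_nonneg hD k m
    have := pairWeight_nonneg hD m k
    linarith
  have t1 := tri a
  have t2 := tri b
  have t3 := tri c
  have e1 := add hab
  have e2 := add hac
  have e3 := add hbc
  rw [pairWeight_comm m] at e1 e2 e3
  have key : ∀ {x y : V}, Separates T m x y →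
      pairWeight D x p = pairWeight D x m + pairWeight D m p ∨
      pairWeight D y p = pairWeight D y m + pairWeight D m p := by
    intro x y h
    exact (h.or p).imp (fun h' => add h') (fun h' => add h'.symm)
  unfold MaxAttainedTwice
  rcases key hab with k1 | k1 <;> rcases key hac with k2 | k2 <;> rcases key hbc with k3 | k3 <;>
    first
    | (left; constructor <;> linarith)
    | (right; left; constructor <;> linarith)
    | (right; right; constructor <;> linarith)

theorem isMedianFamily_of_isTree (hT : T.IsTree) (hw : ∀ e, 0 < w e)
    (hD : ∀ S : Finset V, 2 ≤ S.card → 0 < D S)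
    (hm : ∀ S : Finset V, 2 ≤ S.card → IsMultiweight T w S (D S)) :
    IsMedianFamily D := by
  -- additivity forces `m` to coincide with the median `k` of `x, y, m`
  have sep : ∀ {m x y : V}, pairWeight D x y = pairWeight D x m + pairWeight D y m →
      Separates T m x y := by
    intro m x y h
    obtain ⟨k, h1, h2, h3⟩ := exists_median hT x y m
    have e1 := pairWeight_add_of_separates hT hw hm h1
    have e2 := pairWeight_add_of_separates hT hw hm h2
    have e3 := pairWeight_add_of_separates hT hw hm h3
    rw [pairWeight_comm k y] at e1
    have : k = m := eq_of_pairWeight_nonpos hD (by linarith)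
    exact this ▸ h1
  intro a b c hab hac hbc
  obtain ⟨m, h1, h2, h3⟩ := exists_median hT a b c
  have e1 := pairWeight_add_of_separates hT hw hm h1
  have e2 := pairWeight_add_of_separates hT hw hm h2
  have e3 := pairWeight_add_of_separates hT hw hm h3
  rw [pairWeight_comm m] at e1 e2 e3
  refine ⟨m, ?_, ?_⟩
  · have f1 := e1
    have f2 := e2
    have f3 := e3
    rw [pairWeight_comm, add_comm] at f1 f2 f3
    rintro i (rfl | rfl | rfl) j (rfl | rfl | rfl) hij <;> first | exact absurd rfl hij | assumption
  · intro k hk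
    have k1 := hk a (by simp) b (by simp) hab
    have k2 := hk a (by simp) c (by simp) hac
    have k3 := hk b (by simp) c (by simp) hbc
    -- two medians are at the same distance from `a` and from `b`, which leaves no room between them
    rcases (sep k1).or m with h | h
    · have := pairWeight_add_of_separates hT hw hm h
      exact eq_of_pairWeight_nonpos hD (by linarith)
    · have := pairWeight_add_of_separates hT hw hm h
      rw [pairWeight_comm m b, pairWeight_comm k b, pairWeight_comm m k] at this
      exact eq_of_pairWeight_nonpos hD (by linarith)

end OfTree

/-! ### Multiweights of a tree as least tree sums -/

section TreeSums

variable {V : Type*} {T : SimpleGraph V} {D : Finset V → ℝ}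

theorem toFinset_injective [DecidableEq V] :
    Function.Injective (Sym2.toFinset : Sym2 V → Finset V) := by
  intro e f h
  refine Sym2.ext fun x => ?_
  rw [← Sym2.mem_toFinset, h, Sym2.mem_toFinset]

open Classical in
/-- The edges of `R`, each regarded as a 2-element subset of `V`. -/
noncomputable def edgePairs [Fintype V] [DecidableEq V] (R : T.Subgraph) : Finset (Finset V) :=
  (Finset.univ.filter fun e : T.edgeSet => (e : Sym2 V) ∈ R.edgeSet).image
    fun e : T.edgeSet => (e : Sym2 V).toFinset

theorem mem_edgePairs [Fintype V] [DecidableEq V] {R : T.Subgraph} {I : Finset V} :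
    I ∈ edgePairs R ↔ ∃ u v, R.Adj u v ∧ I = {u, v} := by
  classical
  simp only [edgePairs, Finset.mem_image, Finset.mem_filter, Finset.mem_univ, true_and]
  constructor
  · rintro ⟨⟨⟨u, v⟩, h⟩, hR, rfl⟩
    exact ⟨u, v, hR, Sym2.toFinset_mk_eq⟩
  · rintro ⟨u, v, h, rfl⟩
    exact ⟨⟨s(u, v), h.adj_sub⟩, h, Sym2.toFinset_mk_eq⟩

theorem pair_mem_edgePairs [Fintype V] [DecidableEq V] {R : T.Subgraph} {u v : V} :
    ({u, v} : Finset V) ∈ edgePairs R ↔ R.Adj u v := by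
  rw [mem_edgePairs]
  constructor
  · rintro ⟨a, b, h, he⟩
    have : s(u, v) = s(a, b) := toFinset_injective (by simpa [Sym2.toFinset_mk_eq] using he)
    rw [← Subgraph.mem_edgeSet, this]
    exact h
  · exact fun h => ⟨u, v, h, rfl⟩

theorem sum_edgePairs [Fintype V] [DecidableEq V] {w : T.edgeSet → ℝ} (hT : T.IsAcyclic)
    (hw : ∀ e, 0 < w e)
    (hm : ∀ S : Finset V, 2 ≤ S.card → IsMultiweight T w S (D S)) (R : T.Subgraph) :
    ∑ I ∈ edgePairs R, D I = subgraphWeight w R := by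
  classical
  rw [edgePairs, Finset.sum_image fun e _ f _ h => Subtype.ext (toFinset_injective h)]
  simp only [apply_pair_of_adj hT hw hm]
  rw [Finset.sum_filter]
  rfl

theorem graphOf_edgePairs_adj [Fintype V] [DecidableEq V] {R : T.Subgraph} {u v : V} :
    (graphOf (edgePairs R)).Adj u v ↔ R.Adj u v := by
  change u ≠ v ∧ _ ∈ _ ↔ _
  rw [pair_mem_edgePairs]
  exact ⟨fun h => h.2, fun h => ⟨h.adj_sub.ne, h⟩⟩

theorem graphOf_edgePairs_verts [Fintype V] [DecidableEq V] {R : T.Subgraph}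
    (h : ∀ v ∈ R.verts, ∃ u, R.Adj v u) :
    (graphOf (edgePairs R)).verts = R.verts := by
  ext v
  change (∃ I ∈ edgePairs R, v ∈ I) ↔ _
  constructor
  · rintro ⟨I, hI, hv⟩
    obtain ⟨a, b, hab, rfl⟩ := mem_edgePairs.1 hI
    simp only [Finset.mem_insert, Finset.mem_singleton] at hv
    rcases hv with rfl | rfl
    · exact hab.fst_mem
    · exact hab.snd_mem
  · intro hv
    obtain ⟨u, hu⟩ := h v hv
    exact ⟨{v, u}, mem_edgePairs.2 ⟨v, u, hu, rfl⟩, by simp⟩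

theorem isTree_graphOf_edgePairs [Fintype V] [DecidableEq V] (hT : T.IsAcyclic) {R : T.Subgraph}
    (hR : R.Connected)
    (h : ∀ v ∈ R.verts, ∃ u, R.Adj v u) : (graphOf (edgePairs R)).coe.IsTree := by
  have e : (graphOf (edgePairs R)).coe ≃g R.coe :=
    { Equiv.setCongr (graphOf_edgePairs_verts h) with
      map_rel_iff' := by
        intro x y
        exact graphOf_edgePairs_adj.symm }
  exact e.isTree_iff.2 ⟨hR.coe, hT.subgraph R⟩

theorem connected_deleteVerts_leaf {R : T.Subgraph} (hR : R.Connected) {v : V}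
    (hv : ∃! u, R.Adj v u) (hne : (R.verts \ {v}).Nonempty) : (R.deleteVerts {v}).Connected := by
  obtain ⟨u, hu, huniq⟩ := hv
  rw [Subgraph.connected_iff]
  refine ⟨?_, hne⟩
  have e := Subgraph.coeInduceIso (G' := R) (R.verts \ {v}) Set.sdiff_subset
  constructor
  rw [Subgraph.deleteVerts, e.preconnected_iff]
  refine hR.preconnected.coe.induce_of_degree_eq_one ?_
  rintro ⟨x, hx⟩ hxv
  have hxv : x = v := by simpa [hx] using hxv
  subst hxv
  rintro ⟨a, ha⟩ h1 ⟨b, hb⟩ h2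
  exact Subtype.ext ((huniq a h1).trans (huniq b h2).symm)

theorem subgraphWeight_deleteVerts_lt [Fintype V] {w : T.edgeSet → ℝ} (hw : ∀ e, 0 < w e)
    {R : T.Subgraph} {u v : V}
    (h : R.Adj v u) : subgraphWeight w (R.deleteVerts {v}) < subgraphWeight w R := by
  have h1 : R.deleteVerts {v} ⊔ T.subgraphOfAdj h.adj_sub ≤ R :=
    sup_le Subgraph.deleteVerts_le (subgraphOfAdj_le_of_adj R h)
  have h2 := subgraphWeight_mono hw h1
  rw [subgraphWeight_sup, subgraphWeight_subgraphOfAdj] at h2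
  · linarith [hw ⟨s(v, u), h.adj_sub⟩]
  · rw [edgeSet_subgraphOfAdj, Set.disjoint_singleton_right, Subgraph.mem_edgeSet,
      Subgraph.deleteVerts_adj]
    simp

/-- A connected subgraph of least weight containing `S` is a tree with all its leaves in `S`. -/
theorem mem_treeSums_of_isMultiweight [Fintype V] [DecidableEq V] {w : T.edgeSet → ℝ}
    (hT : T.IsAcyclic) (hw : ∀ e, 0 < w e)
    (hm : ∀ S : Finset V, 2 ≤ S.card → IsMultiweight T w S (D S)) {S : Finset V}
    (hS : 2 ≤ S.card) : D S ∈ treeSums D S := by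
  obtain ⟨⟨R, hR, hSR, hw'⟩, hmin⟩ := hm S hS
  -- as `S` has two elements, no vertex of `R` is isolated, so `R` is determined by its edges
  obtain ⟨s, hs, t, ht, hst⟩ := Finset.one_lt_card.1 hS
  have hadj : ∀ v ∈ R.verts, ∃ u, R.Adj v u := by
    have : Nontrivial R.verts := ⟨⟨s, hSR hs⟩, ⟨t, hSR ht⟩, by simpa using hst⟩
    exact fun v hv => hR.preconnected.exists_adj_of_nontrivial ⟨v, hv⟩
  refine ⟨edgePairs R, ?_, isTree_graphOf_edgePairs hT hR hadj, ?_, ?_, ?_⟩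
  · intro I hI
    obtain ⟨u, v, h, rfl⟩ := mem_edgePairs.1 hI
    exact Finset.card_pair h.adj_sub.ne
  · rintro v ⟨-, hv⟩
    simp only [graphOf_edgePairs_adj] at hv
    -- a leaf outside `S` could be deleted, against minimality
    by_contra hvS
    have hsub : (S : Set V) ⊆ R.verts \ {v} := Set.subset_sdiff_singleton hSR hvS
    have h1 := hmin ⟨_, connected_deleteVerts_leaf hR hv ⟨s, hsub hs⟩, hsub, rfl⟩
    exact absurd (hw' ▸ h1) (subgraphWeight_deleteVerts_lt hw hv.exists.choose_spec).not_ge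
  · rwa [graphOf_edgePairs_verts hadj]
  · rw [sum_edgePairs hT hw hm, hw']

theorem subgraphWeight_finset_sup_le [Fintype V] {w : T.edgeSet → ℝ} (hw : ∀ e, 0 < w e)
    {ι : Type*} (X : Finset ι)
    (f : ι → T.Subgraph) : subgraphWeight w (X.sup f) ≤ ∑ I ∈ X, subgraphWeight w (f I) := by
  classical
  induction X using Finset.induction_on with
  | empty => simp [subgraphWeight]
  | insert I X hI ih =>
    rw [Finset.sup_insert, Finset.sum_insert hI]
    exact (subgraphWeight_sup_le hw _ _).trans (by gcongr)

/-- If `G_X` is connected, so is the union of connected subgraphs `f I ⊇ I` for `I ∈ X`. -/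
theorem connected_finset_sup [DecidableEq V] {X : Finset (Finset V)}
    (hX : (graphOf X).coe.Connected)
    (hne : ∀ I ∈ X, I.Nonempty) {f : Finset V → T.Subgraph}
    (hf : ∀ I ∈ X, (f I).Connected ∧ (I : Set V) ⊆ (f I).verts) : (X.sup f).Connected := by
  have hmem : ∀ v, v ∈ (X.sup f).verts ↔ ∃ I ∈ X, v ∈ (f I).verts := by
    intro v
    rw [Finset.sup_eq_iSup]
    simp
  -- `r u v`: the vertices `u` and `v` are joined by a walk inside the union
  set r : V → V → Prop := fun u v => ∃ p : T.Walk u v, p.toSubgraph ≤ X.sup f with hr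
  have rsymm : ∀ {u v}, r u v → r v u := fun ⟨p, hp⟩ => ⟨p.reverse, by simpa using hp⟩
  have rtrans : ∀ {a b c}, r a b → r b c → r a c := fun ⟨p, hp⟩ ⟨q, hq⟩ =>
    ⟨p.append q, by rw [Walk.toSubgraph_append]; exact sup_le hp hq⟩
  have rblock : ∀ I ∈ X, ∀ u ∈ (f I).verts, ∀ v ∈ (f I).verts, r u v := by
    intro I hI u hu v hv
    obtain ⟨p, hp⟩ := ((Subgraph.connected_iff_forall_exists_walk_subgraph _).1 (hf I hI).1).2 hu hv
    exact ⟨p, hp.trans (Finset.le_sup hI)⟩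
  have rwalk : ∀ {x y : (graphOf X).verts}, (graphOf X).coe.Walk x y → r x y := by
    intro x y p
    induction p with
    | @nil x =>
      obtain ⟨I, hI, hx⟩ := x.2
      exact rblock I hI _ ((hf I hI).2 hx) _ ((hf I hI).2 hx)
    | @cons x y z h p ih =>
      have h' : ({(x : V), (y : V)} : Finset V) ∈ X := h.2
      exact rtrans (rblock _ h' _ ((hf _ h').2 (by simp)) _ ((hf _ h').2 (by simp))) ih
  have rbase : ∀ u ∈ (X.sup f).verts, ∃ x : (graphOf X).verts, r u x := by
    intro u hu
    obtain ⟨I, hI, hu⟩ := (hmem u).1 hu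
    obtain ⟨a, ha⟩ := hne I hI
    exact ⟨⟨a, I, hI, ha⟩, rblock I hI _ hu _ ((hf I hI).2 ha)⟩
  rw [Subgraph.connected_iff_forall_exists_walk_subgraph]
  constructor
  · obtain ⟨⟨v, I, hI, hv⟩⟩ := hX.nonempty
    exact ⟨v, (hmem v).2 ⟨I, hI, (hf I hI).2 hv⟩⟩
  · intro u v hu hv
    obtain ⟨x, hx⟩ := rbase u hu
    obtain ⟨y, hy⟩ := rbase v hv
    obtain ⟨p⟩ := hX.preconnected x y
    exact rtrans (rtrans hx (rwalk p)) (rsymm hy)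

theorem isLeast_treeSums_of_isTree [Fintype V] [DecidableEq V] {w : T.edgeSet → ℝ}
    (hT : T.IsAcyclic) (hw : ∀ e, 0 < w e)
    (hm : ∀ S : Finset V, 2 ≤ S.card → IsMultiweight T w S (D S)) {S : Finset V}
    (hS : 2 ≤ S.card) : IsLeast (treeSums D S) (D S) := by
  refine ⟨mem_treeSums_of_isMultiweight hT hw hm hS, ?_⟩
  rintro x ⟨X, hX, htree, -, hSX, rfl⟩
  have : ∀ I, ∃ R : T.Subgraph, I ∈ X →
      (R.Connected ∧ (I : Set V) ⊆ R.verts) ∧ D I = subgraphWeight w R := by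
    intro I
    by_cases hI : I ∈ X
    · obtain ⟨⟨R, h1, h2, h3⟩, -⟩ := hm I (hX I hI).ge
      exact ⟨R, fun _ => ⟨⟨h1, h2⟩, h3⟩⟩
    · exact ⟨⊤, fun h => absurd h hI⟩
  choose f hf using this
  have hconn : (X.sup f).Connected := connected_finset_sup htree.connected
    (fun I hI => Finset.card_pos.1 (by simp [hX I hI])) (fun I hI => (hf I hI).1)
  calc D S ≤ subgraphWeight w (X.sup f) := by
        refine (hm S hS).2 ⟨_, hconn, fun v hv => ?_, rfl⟩
        obtain ⟨I, hI, hvI⟩ := hSX hv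
        exact (Finset.le_sup (f := f) hI).1 ((hf I hI).1.2 hvI)
    _ ≤ ∑ I ∈ X, subgraphWeight w (f I) := subgraphWeight_finset_sup_le hw X f
    _ = ∑ I ∈ X, D I := Finset.sum_congr rfl fun I hI => ((hf I hI).2).symm

end TreeSums

/-! ### The tree of a median family -/

section CoverGraph

variable {V : Type*} [DecidableEq V] {D : Finset V → ℝ}

/-- The triangle inequality is the 4-point condition for `a, b, c, c`. -/
theorem FourPointCondition.triangle (h : FourPointCondition D) (a b c : V) :
    pairWeight D a b ≤ pairWeight D a c + pairWeight D b c := by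
  have := h a b c c
  rw [pairWeight_self] at this
  rcases this with h | h | h <;> linarith

/-- The graph of indecomposable pairs: `u` and `v` are adjacent when no vertex other than `u` and
`v` lies between them for the 2-weights of `D`. For the 2-weights of a tree with positive weights
this is the tree itself. -/
def coverGraph (D : Finset V → ℝ) : SimpleGraph V where
  Adj u v := u ≠ v ∧ ∀ k, pairWeight D u v = pairWeight D u k + pairWeight D v k → k = u ∨ k = v
  symm := ⟨fun u v h => ⟨h.1.symm, fun k hk =>
    (h.2 k (by rw [pairWeight_comm, hk, add_comm])).symm⟩⟩
  loopless := ⟨fun _ h => h.1 rfl⟩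

/-- Each vertex `x` lies on one side of an edge `uv`, since the median of `x, u, v` is `u` or
`v`. -/
theorem coverGraph_dichotomy (hM : IsMedianFamily D) {u v : V} (h : (coverGraph D).Adj u v)
    (x : V) : pairWeight D x v = pairWeight D x u + pairWeight D u v ∨
      pairWeight D x u = pairWeight D x v + pairWeight D u v := by
  by_cases hxu : x = u
  · left; rw [hxu, pairWeight_self]; ring
  by_cases hxv : x = v
  · right; rw [hxv, pairWeight_self, pairWeight_comm]; ring
  obtain ⟨m, hm, -⟩ := hM x u v hxu hxv h.1
  have e1 := hm u (by simp) v (by simp) h.1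
  have e2 := hm x (by simp) u (by simp) hxu
  have e3 := hm x (by simp) v (by simp) hxv
  rcases h.2 m e1 with rfl | rfl
  · left; rw [e3, pairWeight_comm v]
  · right; rw [e2]

theorem coverGraph_isAcyclic (hD : ∀ S : Finset V, 2 ≤ S.card → 0 < D S)
    (h4 : FourPointCondition D) (hM : IsMedianFamily D) : (coverGraph D).IsAcyclic := by
  rw [isAcyclic_iff_forall_adj_isBridge]
  intro u v huv
  rw [isBridge_iff]
  have huv0 := pairWeight_pos hD huv.1
  -- the vertices on the side of `u` are closed under the adjacency of the graph without `uv`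
  have step : ∀ {x y}, ((coverGraph D).deleteEdges {s(u, v)}).Adj x y →
      pairWeight D x v = pairWeight D x u + pairWeight D u v →
      pairWeight D y v = pairWeight D y u + pairWeight D u v := by
    intro x y hxy hx
    rw [deleteEdges_adj] at hxy
    refine (coverGraph_dichotomy hM huv y).resolve_right fun hy => hxy.2 ?_
    -- `x` is on the side of `u` and `y` on the side of `v`: the 4-point condition puts `u` and `v`
    -- between `x` and `y`, so the edge `xy` is the edge `uv`
    have hxy' : pairWeight D x y = pairWeight D x u + pairWeight D u v + pairWeight D y v := by
      have := h4 u v x y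
      rw [pairWeight_comm u x, pairWeight_comm v y, pairWeight_comm u y, pairWeight_comm v x]
        at this
      rcases this with h | h | h <;> linarith
    have k1 : u = x ∨ u = y := hxy.1.2 u (by linarith)
    have k2 : v = x ∨ v = y := hxy.1.2 v (by linarith)
    rcases k1 with rfl | rfl
    · rcases k2 with rfl | rfl
      · exact absurd rfl huv.1
      · rfl
    · rw [pairWeight_self] at hy
      linarith [pairWeight_nonneg hD u v]
  rintro ⟨p⟩
  have : ∀ {x y}, ((coverGraph D).deleteEdges {s(u, v)}).Walk x y →
      pairWeight D x v = pairWeight D x u + pairWeight D u v →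
      pairWeight D y v = pairWeight D y u + pairWeight D u v := by
    intro x y p
    induction p with
    | nil => exact id
    | cons h p ih => exact fun hx => ih (step h hx)
  have := this p (by rw [pairWeight_self]; ring)
  rw [pairWeight_self, pairWeight_comm v u] at this
  linarith

/-- The weight of an edge of the cover graph is the weight of the pair. -/
noncomputable def coverWeight (D : Finset V → ℝ) (e : (coverGraph D).edgeSet) : ℝ :=
  D (e : Sym2 V).toFinset

theorem coverWeight_mk {u v : V} (h : (coverGraph D).Adj u v) :
    coverWeight D ⟨s(u, v), h⟩ = pairWeight D u v := by
  rw [pairWeight_of_ne h.1, coverWeight, Sym2.toFinset_mk_eq]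

theorem coverWeight_pos (hD : ∀ S : Finset V, 2 ≤ S.card → 0 < D S)
    (e : (coverGraph D).edgeSet) : 0 < coverWeight D e := by
  obtain ⟨⟨u, v⟩, h⟩ := e
  exact (coverWeight_mk h).symm ▸ pairWeight_pos hD h.1

/-- The tree sums depend on the 2-weights only. -/
theorem treeSums_congr {D' : Finset V → ℝ} (h : ∀ I : Finset V, I.card = 2 → D I = D' I)
    (S : Finset V) : treeSums D S = treeSums D' S := by
  ext x
  refine exists_congr fun X => and_congr_right fun hX => ?_
  rw [Finset.sum_congr rfl fun I hI => h I (hX I hI)]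

variable [Fintype V]

theorem exists_walk_coverGraph (hD : ∀ S : Finset V, 2 ≤ S.card → 0 < D S) (a b : V) :
    ∃ p : (coverGraph D).Walk a b,
      subgraphWeight (coverWeight D) p.toSubgraph ≤ pairWeight D a b := by
  have hwf : WellFounded (fun p q : V × V => pairWeight D p.1 p.2 < pairWeight D q.1 q.2) :=
    Finite.wellFounded_of_trans_of_irrefl _
  suffices H : ∀ q : V × V, ∃ p : (coverGraph D).Walk q.1 q.2,
      subgraphWeight (coverWeight D) p.toSubgraph ≤ pairWeight D q.1 q.2 from H (a, b)
  intro q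
  induction q using hwf.induction with
  | _ q ih =>
    obtain ⟨a, b⟩ := q
    dsimp only at ih ⊢
    by_cases hab : a = b
    · subst hab
      exact ⟨Walk.nil, by rw [subgraphWeight_nil, pairWeight_self]⟩
    by_cases hadj : (coverGraph D).Adj a b
    · refine ⟨hadj.toWalk, ?_⟩
      rw [Adj.toSubgraph_toWalk, subgraphWeight_subgraphOfAdj, coverWeight_mk]
    · have : ∃ k, pairWeight D a b = pairWeight D a k + pairWeight D b k ∧ k ≠ a ∧ k ≠ b := by
        by_contra hc
        push Not at hc
        exact hadj ⟨hab, fun k hk => or_iff_not_imp_left.2 (hc k hk)⟩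
      obtain ⟨k, hk, hka, hkb⟩ := this
      rw [pairWeight_comm b k] at hk
      have h1 := pairWeight_pos hD hka.symm
      have h2 := pairWeight_pos hD hkb
      obtain ⟨p, hp⟩ := ih (a, k) (by dsimp only; linarith)
      obtain ⟨q, hq⟩ := ih (k, b) (by dsimp only; linarith)
      refine ⟨p.append q, ?_⟩
      rw [Walk.toSubgraph_append]
      have := subgraphWeight_sup_le (coverWeight_pos hD) p.toSubgraph q.toSubgraph
      dsimp only at hp hq
      linarith

theorem coverGraph_isTree [Nonempty V] (hD : ∀ S : Finset V, 2 ≤ S.card → 0 < D S)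
    (h4 : FourPointCondition D) (hM : IsMedianFamily D) : (coverGraph D).IsTree :=
  ⟨⟨fun a b => ⟨(exists_walk_coverGraph hD a b).choose⟩⟩, coverGraph_isAcyclic hD h4 hM⟩

theorem pairWeight_le_of_isPath (h4 : FourPointCondition D) {a b : V}
    {p : (coverGraph D).Walk a b} (hp : p.IsPath) :
    pairWeight D a b ≤ subgraphWeight (coverWeight D) p.toSubgraph := by
  induction p with
  | nil => rw [subgraphWeight_nil, pairWeight_self]
  | @cons a k b h p ih =>
    have e := subgraphWeight_append (w := coverWeight D) (p := h.toWalk) (q := p) hp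
    change subgraphWeight _ (Walk.cons h p).toSubgraph = _ at e
    rw [e, Adj.toSubgraph_toWalk, subgraphWeight_subgraphOfAdj, coverWeight_mk]
    have := ih hp.of_cons
    have := h4.triangle a b k
    rw [pairWeight_comm b k] at this
    linarith

theorem isMultiweight_coverGraph_pair (hD : ∀ S : Finset V, 2 ≤ S.card → 0 < D S)
    (h4 : FourPointCondition D) (hM : IsMedianFamily D) {a b : V} (hab : a ≠ b) :
    IsMultiweight (coverGraph D) (coverWeight D) {a, b} (D {a, b}) := by
  obtain ⟨q, hq⟩ := exists_walk_coverGraph hD a b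
  have hp := q.bypass_isPath
  have h1 := (subgraphWeight_mono (coverWeight_pos hD) q.toSubgraph_bypass_le_toSubgraph).trans hq
  have h2 := pairWeight_le_of_isPath h4 hp
  rw [← pairWeight_of_ne (D := D) hab, h2.antisymm h1]
  exact isMultiweight_pair (coverGraph_isAcyclic hD h4 hM) (coverWeight_pos hD) hp

theorem isMultiweight_coverGraph [Nonempty V] (hD : ∀ S : Finset V, 2 ≤ S.card → 0 < D S)
    (h4 : FourPointCondition D) (hM : IsMedianFamily D)
    (h3 : ∀ S : Finset V, 3 ≤ S.card → IsLeast (treeSums D S) (D S)) {S : Finset V}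
    (hS : 2 ≤ S.card) : IsMultiweight (coverGraph D) (coverWeight D) S (D S) := by
  have hT := coverGraph_isTree hD h4 hM
  -- `D'` is the family of multiweights of the tree; both families are least tree sums
  choose D' hD' using fun S => exists_isMultiweight hT.connected (coverWeight D) S
  have heq : ∀ I : Finset V, I.card = 2 → D I = D' I := by
    intro I hI
    obtain ⟨a, b, hab, rfl⟩ := Finset.card_eq_two.1 hI
    exact (isMultiweight_coverGraph_pair hD h4 hM hab).unique (hD' _)
  suffices D S = D' S from this ▸ hD' S
  rcases hS.eq_or_lt with h | h
  · exact heq S h.symm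
  · have h' := isLeast_treeSums_of_isTree hT.isAcyclic (coverWeight_pos hD) (fun S _ => hD' S) hS
    rw [← treeSums_congr heq] at h'
    exact (h3 S h).unique h'

end CoverGraph

end TreeMultiweights

theorem theorem3p7 (n : ℕ) (hn : 3 ≤ n) (D : Finset (Fin n) → ℝ)
    (hD : ∀ S : Finset (Fin n), 2 ≤ S.card → 0 < D S) :
    (∃ (T : SimpleGraph (Fin n)) (w : T.edgeSet → ℝ), T.IsTree ∧ (∀ e, 0 < w e) ∧
        ∀ S : Finset (Fin n), 2 ≤ S.card → TreeMultiweights.IsMultiweight T w S (D S)) ↔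
      (TreeMultiweights.FourPointCondition D ∧
        TreeMultiweights.IsMedianFamily D ∧
        ∀ S : Finset (Fin n), 3 ≤ S.card → IsLeast (TreeMultiweights.treeSums D S) (D S)) := by
  have : NeZero n := ⟨by omega⟩
  constructor
  · rintro ⟨T, w, hT, hw, hm⟩
    exact ⟨TreeMultiweights.fourPointCondition_of_isTree hT hw hD hm,
      TreeMultiweights.isMedianFamily_of_isTree hT hw hD hm,
      fun S hS => TreeMultiweights.isLeast_treeSums_of_isTree hT.isAcyclic hw hm (by omega)⟩
  · rintro ⟨h4, hM, h3⟩
    exact ⟨TreeMultiweights.coverGraph D, TreeMultiweights.coverWeight D,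
      TreeMultiweights.coverGraph_isTree hD h4 hM, TreeMultiweights.coverWeight_pos hD,
      fun S hS => TreeMultiweights.isMultiweight_coverGraph hD h4 hM h3 hS⟩
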